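/- All spaces are real. A Banach space is *polyhedral* if each of its finite-dimensional subspaces is isometrically isomorphic to a subspace of some $\ell_\infty^n$, and *isomorphically polyhedral* if it admits an equivalent polyhedral norm. A subset $B$ of the dual unit sphere $S_{X^*}$ is a *boundary* of $X$ if for every $x\in X$ there is $x^*\in B$ with $x^*(x)=\|x\|$. A boundary is *weak\*-$\sigma$-discrete* (respectively *norm-$\sigma$-discrete*) if it is a countable union of sets each of which is relatively discrete in the weak\* topology (respectively in the norm topology) of $X^*$. **Lemma.** Let $X$ be an isomorphically polyhedral Banach space. 1. With respect to every equivalent polyhedral norm, $X$ admits a weak\*-$\sigma$-discrete boundary if and only if it admits a norm-$\sigma$-discrete boundary. 2. Consequently, $X$ has an equivalent polyhedral norm with a weak\*-$\sigma$-discrete boundary if and only if it has an equivalent polyhedral norm with a norm-$\sigma$-discrete boundary. 3. With respect to every equivalent norm, polyhedral or not, if $X$ admits a weak\*-$\sigma$-discrete boundary, then it admits a norm-$\sigma$-discrete boundary. -/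

import Mathlib

universe u

/-- A real normed space is polyhedral if each of its finite-dimensional subspaces is
isometrically isomorphic to a subspace of some `ℓ_∞^n` (`Fin n → ℝ` carries the sup norm). -/
def IsPolyhedral (X : Type u) [NormedAddCommGroup X] [NormedSpace ℝ X] : Prop :=
  ∀ E : Submodule ℝ X, FiniteDimensional ℝ E →
    ∃ n : ℕ, Nonempty (E →ₗᵢ[ℝ] (Fin n → ℝ))

/-- `Y` is a renorming of `X`: up to an isometry, `Y` is the vector space `X` with an equivalent
norm (the norm of `Y` pulled back along a linear homeomorphism). -/
def IsRenorming (X Y : Type u) [NormedAddCommGroup X] [NormedSpace ℝ X]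
    [NormedAddCommGroup Y] [NormedSpace ℝ Y] : Prop :=
  Nonempty (X ≃L[ℝ] Y)

/-- A space is isomorphically polyhedral if it admits a polyhedral renorming. -/
def IsIsomorphicallyPolyhedral (X : Type u) [NormedAddCommGroup X] [NormedSpace ℝ X] : Prop :=
  ∃ (Y : Type u) (_ : NormedAddCommGroup Y) (_ : NormedSpace ℝ Y),
    IsRenorming X Y ∧ IsPolyhedral Y

/-- A set of norm-one functionals is a boundary if every vector attains its norm at one of them. -/
def IsBoundary {X : Type u} [NormedAddCommGroup X] [NormedSpace ℝ X]
    (B : Set (StrongDual ℝ X)) : Prop :=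
  B ⊆ Metric.sphere 0 1 ∧ ∀ x : X, ∃ f ∈ B, f x = ‖x‖

/-- A set is `σ`-discrete if it is a countable union of relatively discrete sets. -/
def IsSigmaDiscrete {T : Type*} [TopologicalSpace T] (B : Set T) : Prop :=
  ∃ D : ℕ → Set T, (∀ n, IsDiscrete (D n)) ∧ B = ⋃ n, D n

/-- `X` has a boundary that is `σ`-discrete in the norm topology of the dual. -/
def HasNormSigmaDiscreteBoundary (X : Type u) [NormedAddCommGroup X] [NormedSpace ℝ X] : Prop :=
  ∃ B : Set (StrongDual ℝ X), IsBoundary B ∧ IsSigmaDiscrete B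

/-- `X` has a boundary that is `σ`-discrete in the weak* topology of the dual. -/
def HasWeakStarSigmaDiscreteBoundary (X : Type u) [NormedAddCommGroup X] [NormedSpace ℝ X] :
    Prop :=
  ∃ B : Set (StrongDual ℝ X), IsBoundary B ∧
    IsSigmaDiscrete (StrongDual.toWeakDual '' B : Set (WeakDual ℝ X))

open Filter Topology

/-! Norm discreteness follows from weak* discreteness because the norm topology is finer. For the
converse, a polyhedral norm has a smallest boundary, `openFaceFunctionals`, and each of its members
is strongly exposed by a vector. Hence a weak* slice isolates it wherever a norm ball does, and
intersecting a norm-σ-discrete boundary with this set gives a weak*-σ-discrete one. Only directional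
affineness of the norm is needed to see that the open faces form a boundary. Baire's theorem over
directions gives, near `x`, an open set whose norming functionals all norm `x`
(`exists_isOpen_normingSet_subset`). A Mazur-type category argument and a separable reduction put a
smooth point in it (`exists_subsingleton`), and the first result at that point yields an open face.
-/

/-- The functionals in the dual unit ball that attain the norm at `x`. -/
def normingSet {X : Type*} [NormedAddCommGroup X] [NormedSpace ℝ X] (x : X) :
    Set (StrongDual ℝ X) :=
  {f | ‖f‖ ≤ 1 ∧ f x = ‖x‖}

/-- Near each point, and in each direction, the norm is affine for a short while: it is computed
by a single functional of the dual unit ball. -/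
def IsDirectionallyAffineNorm (X : Type*) [NormedAddCommGroup X] [NormedSpace ℝ X] : Prop :=
  ∀ x v : X, ∃ t : ℝ, 0 < t ∧ (normingSet x ∩ normingSet (x + t • v)).Nonempty

/-- The functionals of norm one that are the only norming functional at each point of some
nonempty open set. -/
def openFaceFunctionals (X : Type*) [NormedAddCommGroup X] [NormedSpace ℝ X] :
    Set (StrongDual ℝ X) :=
  {f | ‖f‖ = 1 ∧ ∃ V : Set X, IsOpen V ∧ V.Nonempty ∧ ∀ z ∈ V, normingSet z = {f}}

/-! ### Calculus of norming functionals -/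

section NormingSet

variable {X : Type*} [NormedAddCommGroup X] [NormedSpace ℝ X]

lemma apply_le_norm_of_norm_le_one {f : StrongDual ℝ X} (hf : ‖f‖ ≤ 1) (x : X) : f x ≤ ‖x‖ :=
  (le_abs_self _).trans ((f.le_opNorm x).trans (mul_le_of_le_one_left (norm_nonneg _) hf))

lemma normingSet_nonempty (x : X) : (normingSet x).Nonempty := by
  obtain ⟨f, hf, hfx⟩ := exists_dual_vector'' ℝ x
  exact ⟨f, hf, by simpa using hfx⟩

/-- Two vectors have a common norming functional iff the triangle inequality is an equality. -/
lemma normingSet_inter_nonempty_iff {x y : X} :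
    (normingSet x ∩ normingSet y).Nonempty ↔ ‖x + y‖ = ‖x‖ + ‖y‖ := by
  constructor
  · rintro ⟨f, ⟨hf, hx⟩, -, hy⟩
    refine le_antisymm (norm_add_le _ _) ?_
    rw [← hx, ← hy, ← map_add]
    exact apply_le_norm_of_norm_le_one hf _
  · intro h
    obtain ⟨f, hf, hfx⟩ := normingSet_nonempty (x + y)
    rw [map_add, h] at hfx
    have h1 := apply_le_norm_of_norm_le_one hf x
    have h2 := apply_le_norm_of_norm_le_one hf y
    exact ⟨f, ⟨hf, by linarith⟩, hf, by linarith⟩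

/-- A functional that norms two vectors norms their nonnegative combinations. -/
lemma mem_normingSet_combination {f : StrongDual ℝ X} {x y : X} (hx : f ∈ normingSet x)
    (hy : f ∈ normingSet y) {a b : ℝ} (ha : 0 ≤ a) (hb : 0 ≤ b) :
    f ∈ normingSet (a • x + b • y) := by
  refine ⟨hx.1, le_antisymm (apply_le_norm_of_norm_le_one hx.1 _) ?_⟩
  calc ‖a • x + b • y‖ ≤ ‖a • x‖ + ‖b • y‖ := norm_add_le _ _
    _ = f (a • x + b • y) := by
      simp [norm_smul, abs_of_nonneg ha, abs_of_nonneg hb, hx.2, hy.2]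

/-- A functional that norms the ends of a segment norms each of its points. -/
lemma mem_normingSet_segment {f : StrongDual ℝ X} {x v : X} {t s : ℝ} (hx : f ∈ normingSet x)
    (hy : f ∈ normingSet (x + t • v)) (ht : 0 < t) (hs : 0 ≤ s) (hst : s ≤ t) :
    f ∈ normingSet (x + s • v) := by
  have h := mem_normingSet_combination hx hy (a := 1 - s / t) (b := s / t)
    (by rw [sub_nonneg, div_le_one ht]; exact hst) (by positivity)
  convert h using 2
  rw [smul_add, smul_smul, div_mul_cancel₀ _ ht.ne', sub_smul, one_smul]
  abel

/-- If each point of an open set shares a norming functional with `x`, then all the norming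
functionals of its points norm `x`. -/
lemma normingSet_subset_of_isOpen {x : X} {U : Set X} (hU : IsOpen U)
    (h : ∀ y ∈ U, (normingSet x ∩ normingSet y).Nonempty) {y : X} (hy : y ∈ U) :
    normingSet y ⊆ normingSet x := by
  intro f hf
  have hc : Tendsto (fun s : ℝ => y + s • (y - x)) (𝓝[>] 0) (𝓝 y) := by
    have : Continuous fun s : ℝ => y + s • (y - x) := by fun_prop
    simpa using (this.tendsto 0).mono_left nhdsWithin_le_nhds
  -- Push `y` slightly away from `x`: then `y` lies between `x` and the new point, and the norm is
  -- additive on these two. So `f`, norming `y`, must norm both ends.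
  obtain ⟨s, hsU, hs⟩ := ((hc.eventually (hU.mem_nhds hy)).and self_mem_nhdsWithin).exists
  replace hs : 0 < s := hs
  obtain ⟨g, hgx, hgy⟩ := h _ hsU
  have hcomb := mem_normingSet_combination hgy hgx (a := 1) zero_le_one hs.le
  have hsum : (1 : ℝ) • (y + s • (y - x)) + s • x = (1 + s) • y := by module
  have hval := hcomb.2
  rw [hsum, norm_smul, Real.norm_eq_abs, abs_of_pos (by linarith : 0 < 1 + s), ← hf.2,
    ← hsum] at hval
  have hfv : (1 + s) * f y = f (y + s • (y - x)) + s * f x := by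
    simp only [map_add, map_smul, map_sub, smul_eq_mul]; ring
  have hgv : g ((1 : ℝ) • (y + s • (y - x)) + s • x) = ‖y + s • (y - x)‖ + s * ‖x‖ := by
    rw [map_add, map_smul, map_smul, hgx.2, hgy.2]; simp
  have h1 := apply_le_norm_of_norm_le_one hf.1 (y + s • (y - x))
  have h2 := apply_le_norm_of_norm_le_one hf.1 x
  refine ⟨hf.1, le_antisymm h2 (le_of_mul_le_mul_left ?_ hs)⟩
  linarith

end NormingSet

/-! ### Countable rational subspaces -/

section RatSubmodule

/-- The rational span of a countable set is countable. -/
lemma countable_span_rat {X : Type*} [AddCommGroup X] [Module ℚ X] {S : Set X} (hS : S.Countable) :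
    (Submodule.span ℚ S : Set X).Countable := by
  have := hS.to_subtype
  rw [Finsupp.span_eq_range_linearCombination]
  exact Set.countable_range _

/-- Each point lies in a countable rational subspace that is closed under a given map. -/
lemma exists_countable_rat_submodule {X : Type*} [AddCommGroup X] [Module ℚ X] (F : X → X) (w : X) :
    ∃ M : Submodule ℚ X, (M : Set X).Countable ∧ w ∈ M ∧ ∀ y ∈ M, F y ∈ M := by
  obtain ⟨S, hzero, hsucc⟩ : ∃ S : ℕ → Submodule ℚ X, S 0 = Submodule.span ℚ {w} ∧
      ∀ n, S (n + 1) = Submodule.span ℚ ((S n : Set X) ∪ F '' (S n)) :=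
    ⟨fun n => Nat.rec (Submodule.span ℚ {w})
      (fun _ N => Submodule.span ℚ ((N : Set X) ∪ F '' N)) n, rfl, fun _ => rfl⟩
  have hmono : Monotone S := monotone_nat_of_le_succ fun n y hy => by
    rw [hsucc]
    exact Submodule.subset_span (Or.inl hy)
  have hmem : ∀ y, y ∈ ⨆ n, S n ↔ ∃ n, y ∈ S n := fun y =>
    Submodule.mem_iSup_of_directed S hmono.directed_le
  have hcount : ∀ n, (S n : Set X).Countable := by
    intro n
    induction n with
    | zero => exact hzero ▸ countable_span_rat (Set.countable_singleton w)
    | succ n ih => exact hsucc n ▸ countable_span_rat (ih.union (ih.image F))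
  refine ⟨⨆ n, S n, ?_, (hmem w).2 ⟨0, hzero ▸ Submodule.mem_span_singleton_self w⟩, fun y hy => ?_⟩
  · refine (Set.countable_iUnion hcount).mono fun y hy => ?_
    exact Set.mem_iUnion.2 ((hmem y).1 hy)
  · obtain ⟨n, hn⟩ := (hmem y).1 hy
    refine (hmem _).2 ⟨n + 1, ?_⟩
    rw [hsucc]
    exact Submodule.subset_span (Or.inr ⟨y, hn, rfl⟩)

end RatSubmodule

/-! ### Smooth points and open faces -/

section DirectionallyAffine

variable {X : Type*} [NormedAddCommGroup X] [NormedSpace ℝ X]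

/-- In `ℓ_∞^n`, the norm is affine on a short segment starting at `x` in the direction `v`. -/
lemma exists_pos_norm_add_eq_pi (n : ℕ) (x v : Fin n → ℝ) :
    ∃ t : ℝ, 0 < t ∧ ‖x + (x + t • v)‖ = ‖x‖ + ‖x + t • v‖ := by
  have hc : Tendsto (fun t : ℝ => x + t • v) (𝓝[>] 0) (𝓝 x) := by
    have : Continuous fun t : ℝ => x + t • v := by fun_prop
    simpa using (this.tendsto 0).mono_left nhdsWithin_le_nhds
  -- A signed coordinate below the norm at `x` stays below it nearby, so one that attains the norm
  -- at `x + t • v` already attains it at `x`.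
  have h1 : ∀ᶠ y in 𝓝 x, ∀ i, x i < ‖x‖ → y i < ‖y‖ := by
    refine eventually_all.2 fun i => ?_
    by_cases h : x i < ‖x‖
    · have ho : IsOpen {y : Fin n → ℝ | y i < ‖y‖} := isOpen_lt (by fun_prop) (by fun_prop)
      filter_upwards [ho.mem_nhds h] with y hy _ using hy
    · exact Eventually.of_forall fun y hy => absurd hy h
  have h2 : ∀ᶠ y in 𝓝 x, ∀ i, -x i < ‖x‖ → -y i < ‖y‖ := by
    refine eventually_all.2 fun i => ?_
    by_cases h : -x i < ‖x‖
    · have ho : IsOpen {y : Fin n → ℝ | -y i < ‖y‖} := isOpen_lt (by fun_prop) (by fun_prop)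
      filter_upwards [ho.mem_nhds h] with y hy _ using hy
    · exact Eventually.of_forall fun y hy => absurd hy h
  obtain ⟨t, ⟨ht1, ht2⟩, ht⟩ :=
    ((hc.eventually (h1.and h2)).and self_mem_nhdsWithin).exists
  refine ⟨t, ht, le_antisymm (norm_add_le _ _) ?_⟩
  generalize x + t • v = y at ht1 ht2
  rcases eq_or_ne y 0 with rfl | hy
  · simp
  obtain ⟨i, hi⟩ : ∃ i, ‖y‖ ≤ |y i| := by
    by_contra! h
    exact lt_irrefl _ ((pi_norm_lt_iff (norm_pos_iff.2 hy)).2 h)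
  have hle : |x i + y i| ≤ ‖x + y‖ := norm_le_pi_norm (x + y) i
  rcases abs_cases (y i) with ⟨ha, -⟩ | ⟨ha, -⟩
  · have hx : ‖x‖ ≤ x i := by
      by_contra! h
      linarith [ht1 i h]
    linarith [le_abs_self (x i + y i)]
  · have hx : ‖x‖ ≤ -x i := by
      by_contra! h
      linarith [ht2 i h]
    linarith [neg_le_abs (x i + y i)]

/-- Only the span of `x` and `v` matters, and it embeds in some `ℓ_∞^n`. -/
lemma IsPolyhedral.isDirectionallyAffineNorm {X : Type*} [NormedAddCommGroup X]
    [NormedSpace ℝ X] (hX : IsPolyhedral X) : IsDirectionallyAffineNorm X := by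
  intro x v
  have hfin : FiniteDimensional ℝ (Submodule.span ℝ ({x, v} : Set X)) :=
    FiniteDimensional.span_of_finite ℝ (Set.toFinite _)
  obtain ⟨n, ⟨T⟩⟩ := hX _ hfin
  let x' : Submodule.span ℝ ({x, v} : Set X) := ⟨x, Submodule.subset_span (by simp)⟩
  let v' : Submodule.span ℝ ({x, v} : Set X) := ⟨v, Submodule.subset_span (by simp)⟩
  obtain ⟨t, ht, h⟩ := exists_pos_norm_add_eq_pi n (T x') (T v')
  refine ⟨t, ht, normingSet_inter_nonempty_iff.2 ?_⟩
  rw [← map_smul, ← map_add, ← map_add, T.norm_map, T.norm_map, T.norm_map] at h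
  exact h

/-- The equality criterion for a common norming functional involves norms only, so it is intrinsic
to the subspace. -/
lemma IsDirectionallyAffineNorm.submodule (hX : IsDirectionallyAffineNorm X)
    (Z : Submodule ℝ X) : IsDirectionallyAffineNorm Z := by
  intro x v
  obtain ⟨t, ht, h⟩ := hX x v
  have h' := normingSet_inter_nonempty_iff.1 h
  exact ⟨t, ht, normingSet_inter_nonempty_iff.2 h'⟩

/-- By Baire's theorem, each neighbourhood of `x` contains a nonempty open set at the points of
which only functionals that norm `x` are norming. -/
lemma IsDirectionallyAffineNorm.exists_isOpen_normingSet_subset [CompleteSpace X]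
    (hX : IsDirectionallyAffineNorm X) {x : X} {W : Set X} (hW : W ∈ 𝓝 x) :
    ∃ U ⊆ W, IsOpen U ∧ U.Nonempty ∧ ∀ y ∈ U, normingSet y ⊆ normingSet x := by
  -- `A n` collects the directions along which the norm is affine from `x` up to time `1 / n`.
  let A : ℕ → Set X := fun n => {v | ∀ s : ℝ, 0 ≤ s → s * n ≤ 1 →
    ‖x + (x + s • v)‖ = ‖x‖ + ‖x + s • v‖}
  have hclosed : ∀ n, IsClosed (A n) := by
    intro n
    simp only [A, Set.ofPred_forall]
    exact isClosed_iInter fun s => isClosed_iInter fun _ => isClosed_iInter fun _ =>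
      isClosed_eq (by fun_prop) (by fun_prop)
  have hcover : ⋃ n, A n = Set.univ := by
    refine Set.eq_univ_of_forall fun v => Set.mem_iUnion.2 ?_
    obtain ⟨t, ht, f, hfx, hfv⟩ := hX x v
    obtain ⟨n, hn⟩ := exists_nat_ge (1 / t)
    refine ⟨n, fun s hs hsn => normingSet_inter_nonempty_iff.1
      ⟨f, hfx, mem_normingSet_segment hfx hfv ht hs ?_⟩⟩
    rw [div_le_iff₀ ht] at hn
    rcases hs.eq_or_lt with rfl | hs'
    · exact ht.le
    · by_contra! hlt
      have hn0 : (0 : ℝ) < n := by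
        by_contra! h0
        nlinarith
      nlinarith
  obtain ⟨n, v, hv⟩ := nonempty_interior_of_iUnion_of_closed hclosed hcover
  have hc : Tendsto (fun s : ℝ => x + s • v) (𝓝[>] 0) (𝓝 x) := by
    have : Continuous fun s : ℝ => x + s • v := by fun_prop
    simpa using (this.tendsto 0).mono_left nhdsWithin_le_nhds
  have hc' : Tendsto (fun s : ℝ => s * n) (𝓝[>] 0) (𝓝 0) := by
    have : Continuous fun s : ℝ => s * n := by fun_prop
    simpa using (this.tendsto 0).mono_left nhdsWithin_le_nhds
  obtain ⟨s, ⟨hsW, hsn⟩, hs⟩ := ((((hc.eventually (interior_mem_nhds.2 hW)).and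
    (hc'.eventually (Iic_mem_nhds zero_lt_one)))).and self_mem_nhdsWithin).exists
  replace hs : 0 < s := hs
  let U : Set X := {y | s⁻¹ • (y - x) ∈ interior (A n)}
  have hU : IsOpen U := isOpen_interior.preimage (by fun_prop)
  refine ⟨U ∩ interior W, Set.inter_subset_right.trans interior_subset,
    hU.inter isOpen_interior, ⟨x + s • v, ?_, hsW⟩, fun y hy => ?_⟩
  · simpa [U, smul_smul, inv_mul_cancel₀ hs.ne'] using hv
  · refine normingSet_subset_of_isOpen hU (fun z hz => ?_) hy.1
    have h := interior_subset hz s hs.le hsn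
    rw [smul_smul, mul_inv_cancel₀ hs.ne', one_smul, add_sub_cancel] at h
    exact normingSet_inter_nonempty_iff.2 h

/-- In the separable case, each nonempty open set contains a point with only one norming
functional. -/
lemma IsDirectionallyAffineNorm.exists_subsingleton_of_separable [CompleteSpace X]
    [TopologicalSpace.SeparableSpace X] (hX : IsDirectionallyAffineNorm X) {W : Set X}
    (hW : IsOpen W) (hne : W.Nonempty) : ∃ y ∈ W, (normingSet y).Subsingleton := by
  -- Small second differences along a dense sequence of directions: a point in every `G p` has a
  -- single norming functional.
  let G : ℕ × ℕ → Set X := fun p => ⋃ t : Set.Ioi (0 : ℝ),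
    {y | ‖y + t.1 • TopologicalSpace.denseSeq X p.1‖ +
      ‖y - t.1 • TopologicalSpace.denseSeq X p.1‖ - 2 * ‖y‖ < t.1 * (1 / (p.2 + 1 : ℝ))}
  have hopen : ∀ p, IsOpen (G p) := fun p =>
    isOpen_iUnion fun t => isOpen_lt (by fun_prop) (by fun_prop)
  have hdense : ∀ p, Dense (G p) := by
    intro p y
    set v := TopologicalSpace.denseSeq X p.1
    obtain ⟨t, ht, f, hfy, hfv⟩ := hX y v
    have hc : Tendsto (fun s : ℝ => y + s • v) (𝓝[>] 0) (𝓝 y) := by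
      have : Continuous fun s : ℝ => y + s • v := by fun_prop
      simpa using (this.tendsto 0).mono_left nhdsWithin_le_nhds
    refine mem_closure_of_tendsto hc ?_
    -- For `s < t / 2`, `y + s • v` is the midpoint of a segment on which the norm is affine, so its
    -- second difference is zero.
    filter_upwards [Ioo_mem_nhdsGT (half_pos ht)] with s hs
    have hseg : ∀ r, 0 ≤ r → r ≤ t → ‖y + r • v‖ = f y + r * f v := fun r h0 h1 => by
      rw [← (mem_normingSet_segment hfy hfv ht h0 h1).2]; simp
    refine Set.mem_iUnion.2 ⟨⟨s, hs.1⟩, ?_⟩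
    have e1 : y + s • v + s • v = y + (2 * s) • v := by module
    have e2 : y + s • v - s • v = y + (0 : ℝ) • v := by module
    change ‖y + s • v + s • v‖ + ‖y + s • v - s • v‖ - 2 * ‖y + s • v‖ < s * _
    rw [e1, e2, hseg _ (by linarith [hs.1]) (by linarith [hs.2]), hseg _ le_rfl ht.le,
      hseg _ hs.1.le (by linarith [hs.2, hs.1])]
    have : 0 < s * (1 / (p.2 + 1 : ℝ)) := mul_pos hs.1 (by positivity)
    linarith
  obtain ⟨y, hyW, hy⟩ := (dense_iInter_of_isOpen hopen hdense).inter_open_nonempty W hW hne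
  rw [Set.mem_iInter] at hy
  refine ⟨y, hyW, ?_⟩
  have key : ∀ f ∈ normingSet y, ∀ g ∈ normingSet y, ∀ k,
      f (TopologicalSpace.denseSeq X k) ≤ g (TopologicalSpace.denseSeq X k) := by
    intro f hf g hg k
    refine le_of_forall_pos_le_add fun ε hε => ?_
    obtain ⟨n, hn⟩ := exists_nat_one_div_lt hε
    obtain ⟨⟨t, ht⟩, hlt⟩ := Set.mem_iUnion.1 (hy (k, n))
    rw [Set.mem_Ioi] at ht
    have h1 := apply_le_norm_of_norm_le_one hf.1 (y + t • TopologicalSpace.denseSeq X k)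
    have h2 := apply_le_norm_of_norm_le_one hg.1 (y - t • TopologicalSpace.denseSeq X k)
    simp only [map_add, map_sub, map_smul, smul_eq_mul, hf.2, hg.2] at h1 h2
    simp only [Set.mem_ofPred_eq] at hlt
    refine le_of_mul_le_mul_left ?_ ht
    have h3 := mul_lt_mul_of_pos_left hn ht
    rw [mul_add]
    linarith
  intro f hf g hg
  refine DFunLike.coe_injective ((TopologicalSpace.denseRange_denseSeq X).equalizer
    f.continuous g.continuous (funext fun k => ?_))
  exact le_antisymm (key f hf g hg k) (key g hg f hf k)

/-- From a point with a single norming functional to an open set with the same functional. -/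
lemma IsDirectionallyAffineNorm.exists_isOpen_normingSet_eq [CompleteSpace X]
    (hX : IsDirectionallyAffineNorm X) {y : X} (hy : (normingSet y).Subsingleton) {W : Set X}
    (hW : W ∈ 𝓝 y) :
    ∃ V ⊆ W, IsOpen V ∧ V.Nonempty ∧ ∃ f, ∀ z ∈ V, normingSet z = {f} := by
  obtain ⟨V, hVW, hV, hVne, h⟩ := hX.exists_isOpen_normingSet_subset hW
  obtain ⟨f, hf⟩ := normingSet_nonempty y
  refine ⟨V, hVW, hV, hVne, f, fun z hz => ?_⟩
  have hsub : normingSet z ⊆ {f} := fun g hg => hy (h z hz hg) hf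
  exact (Set.subset_singleton_iff_eq.1 hsub).resolve_left (normingSet_nonempty z).ne_empty

/-- The closure of a rational subspace, as a real subspace. -/
def Submodule.ratClosure [Module ℚ X] (M : Submodule ℚ X) : Submodule ℝ X where
  carrier := closure (M : Set X)
  add_mem' := fun ha hb => map_mem_closure₂ continuous_add ha hb fun _ h _ h' => M.add_mem h h'
  zero_mem' := subset_closure M.zero_mem
  smul_mem' := fun c _ hx => map_mem_closure₂ continuous_smul (Rat.denseRange_cast c) hx (by
    rintro _ ⟨q, rfl⟩ y hy
    change (q : ℝ) • y ∈ (M : Set X)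
    rw [Rat.cast_smul_eq_qsmul]
    exact M.smul_mem q hy)

/-- Each nonempty open set contains a point with only one norming functional. -/
lemma IsDirectionallyAffineNorm.exists_subsingleton [CompleteSpace X]
    (hX : IsDirectionallyAffineNorm X) {W : Set X} (hW : IsOpen W) (hne : W.Nonempty) :
    ∃ y ∈ W, (normingSet y).Subsingleton := by
  by_contra! hcon
  have hsep : ∀ y, ∃ v, y ∈ W → ∃ f ∈ normingSet y, ∃ g ∈ normingSet y, f v ≠ g v := by
    intro y
    by_cases hy : y ∈ W
    · obtain ⟨f, hf, g, hg, hfg⟩ := hcon y hy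
      obtain ⟨v, hv⟩ := DFunLike.ne_iff.1 hfg
      exact ⟨v, fun _ => ⟨f, hf, g, hg, hv⟩⟩
    · exact ⟨0, fun h => absurd h hy⟩
  choose F hF using hsep
  obtain ⟨w, hw⟩ := hne
  let _ : Module ℚ X := Module.compHom X (algebraMap ℚ ℝ)
  obtain ⟨M, hMc, hwM, hMF⟩ := exists_countable_rat_submodule F w
  let Z := M.ratClosure
  have hZ : (Z : Set X) = closure (M : Set X) := rfl
  have hMZ : ∀ y ∈ M, y ∈ Z := fun y hy => subset_closure hy
  have hcomplete : CompleteSpace Z := (hZ ▸ isClosed_closure : IsClosed (Z : Set X)).completeSpace_coe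
  have hsepZ : TopologicalSpace.SeparableSpace Z :=
    (hZ ▸ hMc.isSeparable.closure : TopologicalSpace.IsSeparable (Z : Set X)).separableSpace
  have hZX := hX.submodule Z
  have hWZ : IsOpen ((↑) ⁻¹' W : Set Z) := hW.preimage continuous_subtype_val
  obtain ⟨y, hyW, hy⟩ := hZX.exists_subsingleton_of_separable hWZ ⟨⟨w, hMZ w hwM⟩, hw⟩
  -- The smooth point `y` may lie outside `M`; spreading uniqueness to an open set of `Z` lets
  -- density supply `m ∈ M`. Its separating direction `F m` stays in `Z`, a contradiction.
  obtain ⟨V, hVW, hV, ⟨z, hzV⟩, e, he⟩ :=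
    hZX.exists_isOpen_normingSet_eq hy (hWZ.mem_nhds hyW)
  obtain ⟨O, hO, rfl⟩ := isOpen_induced_iff.1 hV
  obtain ⟨m, hmO, hmM⟩ := mem_closure_iff.1 (hZ ▸ z.2 : (z : X) ∈ closure (M : Set X)) O hO hzV
  obtain ⟨f, hf, g, hg, hfg⟩ := hF m (hVW (a := ⟨m, hMZ m hmM⟩) hmO)
  have hres : ∀ f ∈ normingSet m, f.comp Z.subtypeL = e := by
    intro f hf
    have : f.comp Z.subtypeL ∈ normingSet (⟨m, hMZ m hmM⟩ : Z) := by
      refine ⟨ContinuousLinearMap.opNorm_le_bound _ zero_le_one fun u => ?_, hf.2⟩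
      exact (f.le_opNorm u).trans (mul_le_mul_of_nonneg_right hf.1 (norm_nonneg _))
    rw [he _ hmO] at this
    exact this
  exact hfg (DFunLike.congr_fun ((hres f hf).trans (hres g hg).symm) ⟨F m, hMZ _ (hMF m hmM)⟩)

/-- The functionals with an open face form a boundary. -/
lemma IsDirectionallyAffineNorm.isBoundary_openFaceFunctionals {X : Type*} [NormedAddCommGroup X]
    [NormedSpace ℝ X] [CompleteSpace X] [Nontrivial X] (hX : IsDirectionallyAffineNorm X) :
    IsBoundary (openFaceFunctionals X) := by
  refine ⟨fun f hf => by simpa using hf.1, fun x => ?_⟩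
  obtain ⟨U, -, hU, hUne, hUx⟩ := hX.exists_isOpen_normingSet_subset (univ_mem : _ ∈ 𝓝 x)
  obtain ⟨y, hyU, hy⟩ := hX.exists_subsingleton hU hUne
  obtain ⟨V, hVU, hV, hVne, f, hf⟩ := hX.exists_isOpen_normingSet_eq hy (hU.mem_nhds hyU)
  have hmem : ∀ z ∈ V, f ∈ normingSet z := fun z hz => by rw [hf z hz]; rfl
  obtain ⟨z, hz⟩ := hVne
  refine ⟨f, ⟨?_, V, hV, ⟨z, hz⟩, hf⟩, (hUx z (hVU hz) (hmem z hz)).2⟩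
  obtain ⟨g, hg, hgz⟩ := exists_dual_vector' ℝ z
  have hgmem : g ∈ normingSet z := ⟨hg.le, by simpa using hgz⟩
  rw [hf z hz] at hgmem
  rwa [← Set.mem_singleton_iff.1 hgmem]

end DirectionallyAffine

/-! ### Transfer of σ-discreteness -/

section SigmaDiscrete

/-- The functionals with an open face belong to each boundary. -/
lemma IsBoundary.openFaceFunctionals_subset {X : Type*} [NormedAddCommGroup X] [NormedSpace ℝ X]
    {B : Set (StrongDual ℝ X)} (hB : IsBoundary B) : openFaceFunctionals X ⊆ B := by
  rintro f ⟨-, V, -, ⟨z, hz⟩, hV⟩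
  obtain ⟨g, hgB, hgz⟩ := hB.2 z
  have hg : g ∈ normingSet z := ⟨(by simpa using hB.1 hgB : ‖g‖ = 1).le, hgz⟩
  rw [hV z hz] at hg
  rwa [← Set.mem_singleton_iff.1 hg]

/-- A functional with an open face is strongly exposed in the dual unit ball by a vector. -/
lemma exists_strongly_exposing {X : Type*} [NormedAddCommGroup X] [NormedSpace ℝ X]
    {f : StrongDual ℝ X} (hf : f ∈ openFaceFunctionals X) {r : ℝ} (hr : 0 < r) :
    ∃ z : X, ∃ δ > 0, ∀ g : StrongDual ℝ X, ‖g‖ ≤ 1 → f z - δ < g z → ‖g - f‖ < r := by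
  obtain ⟨-, V, hV, ⟨z, hz⟩, hVf⟩ := hf
  obtain ⟨ρ, hρ, hball⟩ := Metric.isOpen_iff.1 hV z hz
  -- On the ball, `g ≤ f`, so `(g - f) u ≤ f z - g z < δ` for `‖u‖ ≤ ρ / 2`; rescaling gives `‖g -
  -- f‖ ≤ r / 2`.
  refine ⟨z, (r / 2) * (ρ / 2), by positivity, fun g hg hgz => ?_⟩
  have hval : ∀ u ∈ V, g u ≤ f u := fun u hu => by
    have : f ∈ normingSet u := by rw [hVf u hu]; rfl
    rw [this.2]
    exact apply_le_norm_of_norm_le_one hg u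
  have hle : ∀ u : X, ‖u‖ ≤ ρ / 2 → (g - f) u ≤ (r / 2) * (ρ / 2) := fun u hu => by
    have h := hval (z + u) (hball (by simp; linarith))
    simp only [map_add, sub_apply] at h ⊢
    linarith
  have hbound : ‖g - f‖ ≤ r / 2 := by
    refine ContinuousLinearMap.opNorm_le_of_unit_norm (by positivity) fun u hu => ?_
    have h1 := hle ((ρ / 2) • u) (by rw [norm_smul, hu, Real.norm_of_nonneg] <;> linarith)
    have h2 := hle (-((ρ / 2) • u))
      (by rw [norm_neg, norm_smul, hu, Real.norm_of_nonneg] <;> linarith)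
    rw [map_neg] at h2
    rw [map_smul, smul_eq_mul] at h1 h2
    rw [Real.norm_eq_abs, abs_le]
    constructor <;> refine le_of_mul_le_mul_left ?_ (half_pos hρ) <;> linarith
  linarith

/-- A norm discrete set of functionals with open faces is weak* discrete. -/
lemma IsDiscrete.image_toWeakDual {X : Type*} [NormedAddCommGroup X] [NormedSpace ℝ X]
    {D : Set (StrongDual ℝ X)} (hD : IsDiscrete D) (hDf : D ⊆ openFaceFunctionals X) :
    IsDiscrete (StrongDual.toWeakDual '' D : Set (WeakDual ℝ X)) := by
  rw [isDiscrete_iff_forall_mem_exists_isOpen] at hD ⊢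
  rintro _ ⟨f, hf, rfl⟩
  obtain ⟨u, hu, huD⟩ := hD f hf
  have hfu : f ∈ u := (huD.symm ▸ Set.mem_singleton f : f ∈ u ∩ D).1
  obtain ⟨r, hr, hball⟩ := Metric.isOpen_iff.1 hu f hfu
  obtain ⟨z, δ, hδ, hz⟩ := exists_strongly_exposing (hDf hf) hr
  refine ⟨{φ | f z - δ < φ z}, isOpen_lt continuous_const (WeakDual.eval_continuous z), ?_⟩
  refine Set.Subset.antisymm ?_ ?_
  · rintro _ ⟨hg, g, hgD, rfl⟩
    have hgu : g ∈ u ∩ D :=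
      ⟨hball (mem_ball_iff_norm.2 (hz g (hDf hgD).1.le hg)), hgD⟩
    rw [huD] at hgu
    rw [Set.mem_singleton_iff.1 hgu]
    rfl
  · refine Set.singleton_subset_iff.2 ⟨?_, f, hf, rfl⟩
    change f z - δ < f z
    linarith

lemma IsDirectionallyAffineNorm.hasWeakStarSigmaDiscreteBoundary {X : Type*}
    [NormedAddCommGroup X] [NormedSpace ℝ X] [CompleteSpace X]
    (hX : IsDirectionallyAffineNorm X) (h : HasNormSigmaDiscreteBoundary X) :
    HasWeakStarSigmaDiscreteBoundary X := by
  obtain ⟨B, hB, D, hD, rfl⟩ := h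
  -- The zero space has no functional of norm one, hence no boundary.
  have hnt : Nontrivial X := by
    by_contra hsub
    rw [not_nontrivial_iff_subsingleton] at hsub
    obtain ⟨f, hf, -⟩ := hB.2 0
    have hf1 : ‖f‖ = 1 := by simpa using hB.1 hf
    rw [Subsingleton.elim f 0, norm_zero] at hf1
    exact zero_ne_one hf1
  refine ⟨openFaceFunctionals X, hX.isBoundary_openFaceFunctionals,
    fun n => StrongDual.toWeakDual '' (D n ∩ openFaceFunctionals X),
    fun n => ((hD n).mono Set.inter_subset_left).image_toWeakDual Set.inter_subset_right, ?_⟩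
  rw [← Set.image_iUnion, ← Set.iUnion_inter,
    Set.inter_eq_self_of_subset_right hB.openFaceFunctionals_subset]

lemma HasWeakStarSigmaDiscreteBoundary.hasNormSigmaDiscreteBoundary {X : Type*}
    [NormedAddCommGroup X] [NormedSpace ℝ X] (h : HasWeakStarSigmaDiscreteBoundary X) :
    HasNormSigmaDiscreteBoundary X := by
  obtain ⟨B, hB, D, hD, hBD⟩ := h
  refine ⟨B, hB, fun n => StrongDual.toWeakDual ⁻¹' D n, fun n => ?_, ?_⟩
  · exact (hD n).preimage NormedSpace.Dual.toWeakDual_continuous.continuousOn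
      StrongDual.toWeakDual.injective
  · rw [← Set.preimage_iUnion, ← hBD, Set.preimage_image_eq _ StrongDual.toWeakDual.injective]

end SigmaDiscrete

theorem mainTheorem4 {X : Type u} [NormedAddCommGroup X] [NormedSpace ℝ X] [CompleteSpace X]
    (hX : IsIsomorphicallyPolyhedral X) :
    -- with respect to each polyhedral renorming
    (∀ (Y : Type u) [NormedAddCommGroup Y] [NormedSpace ℝ Y],
      IsRenorming X Y → IsPolyhedral Y →
        (HasWeakStarSigmaDiscreteBoundary Y ↔ HasNormSigmaDiscreteBoundary Y)) ∧
    -- up to a polyhedral renorming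
    ((∃ (Y : Type u) (_ : NormedAddCommGroup Y) (_ : NormedSpace ℝ Y),
        IsRenorming X Y ∧ IsPolyhedral Y ∧ HasWeakStarSigmaDiscreteBoundary Y) ↔
      (∃ (Y : Type u) (_ : NormedAddCommGroup Y) (_ : NormedSpace ℝ Y),
        IsRenorming X Y ∧ IsPolyhedral Y ∧ HasNormSigmaDiscreteBoundary Y)) ∧
    -- the direct implication with respect to every renorming, polyhedral or not
    (∀ (Y : Type u) [NormedAddCommGroup Y] [NormedSpace ℝ Y],
      IsRenorming X Y →
        HasWeakStarSigmaDiscreteBoundary Y → HasNormSigmaDiscreteBoundary Y) := by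
  have key : ∀ (Y : Type u) [NormedAddCommGroup Y] [NormedSpace ℝ Y],
      IsRenorming X Y → IsPolyhedral Y →
        (HasWeakStarSigmaDiscreteBoundary Y ↔ HasNormSigmaDiscreteBoundary Y) := by
    intro Y _ _ ⟨e⟩ hY
    have : CompleteSpace Y := (completeSpace_congr (e := e.toEquiv) e.isUniformEmbedding).1 inferInstance
    exact ⟨fun h => h.hasNormSigmaDiscreteBoundary,
      hY.isDirectionallyAffineNorm.hasWeakStarSigmaDiscreteBoundary⟩
  refine ⟨key, ⟨?_, ?_⟩, fun Y _ _ _ h => h.hasNormSigmaDiscreteBoundary⟩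
  · rintro ⟨Y, _, _, hXY, hY, h⟩
    exact ⟨Y, _, _, hXY, hY, (key Y hXY hY).1 h⟩
  · rintro ⟨Y, _, _, hXY, hY, h⟩
    exact ⟨Y, _, _, hXY, hY, (key Y hXY hY).2 h⟩
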